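/- **Setting.** *Terms.* Let $\mathcal K_+,\mathcal K_-$ be sets of positive and negative instructions, $\mathcal K_+$ containing pairwise distinct constants $\overline n$ ($n\in\mathbb N$). The terms of the focalising system L are (up to $\alpha$-equivalence): values $V::=V_+\mid t_-$; positive values $V_+::=x\mid (V,V')\mid\{V\}\mid k_+$; positive terms $t_+::=V_+\mid\mu\alpha.c$; negative terms $t_-::=\alpha\mid\mu(\kappa,\kappa').c\mid\mu\{\kappa\}.c\mid\mu x.c\mid k_-$; commands $c::=\langle t_+|t_-\rangle$ (identified with $\langle t_-|t_+\rangle$). *Interpretation.* Let $\mathcal M$ be a commutative monoid of weights and $\bot\!\!\!\bot$ a set of weighted closed commands $(c,p)$, $p\in\mathcal M$. For a set $X$ of weighted closed positive values, $X^\bot$ is the set of all $(t_-,q)$, $t_-$ a closed negative term, with $(\langle v|t_-\rangle,p+q)\in\bot\!\!\!\bot$ for all $(v,p)\in X$. Put $X\otimes Y=\{((t,u),p+q):(t,p)\in X,(u,q)\in Y\}$ and $\downarrow X=\{(\{t\},p):(t,p)\in X\}$. A *positive propositional domain* is a set $\mathcal D^\oplus$ of sets of weighted closed positive values closed under arbitrary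 unions and nonempty intersections, and such that $X\otimes Y,\downarrow X\in\mathcal D^\oplus$ for all $X,Y\in\mathcal D^\oplus\cup\mathcal D^\ominus$, where $\mathcal D^\ominus=\{X^\bot:X\in\mathcal D^\oplus\}$. The kinds $\iota,o^+,o^-,\sigma\to\tau$ are interpreted by $\mathbb N$, $\mathcal D^\oplus$, $\mathcal D^\ominus$ and function sets; a *total valuation* maps every variable $x^\sigma$ to an element of the interpretation of $\sigma$. The constructors of MAL$\omega$ are interpreted with $|A\otimes B|=|A|\otimes|B|$, $|A\parr B|=(|A^\bot|\otimes|B^\bot|)^\bot$, $|{\downarrow}A|={\downarrow}|A|$, $|{\uparrow}A|=({\downarrow}|A^\bot|)^\bot$, $|(X^{o^+})^\bot|=|X|^\bot$, $\exists$ and $\forall$ of positive formulas as union and intersection, $|\forall x.N|=(\bigcup_v|N^\bot|)^\bot$, $|\exists x.N|=(\bigcap_v|N^\bot|)^\bot$, the $\lambda$-calculus part and the recursor as usual. Moreover $|\langle T=U\rangle A|_\rho=|A|_\rho$ if $|T|_\rho=|U|_\rho$; otherwise it is $\emptyset$ for positive $A$ and $\emptyset^\bot$ for negative $A$. *MAL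 and forcing.* MAL formulas are generated by $X,\ X^\bot,\ A\otimes B,\ A\parr B,\ {\downarrow}A,\ {\uparrow}A$, and are seen as MAL$\omega$ formulas in which $X$ is the variable $X^{o^+}$. Let $\mathcal C[\cdot]$ be a new predicate of kind $\iota\to o^+$ and $+$ the addition of MAL$\omega$ individuals. For $Z:\iota\to o^{\pm}$ put $\overline Z=\lambda r.\forall r'.\,Z(r')\multimap\mathcal C[r+r']^\bot$, where $A\multimap B=A^\bot\parr B$, and define $X^*=X^{\iota\to o^+}$, $(X^\bot)^*=\overline{X^{\iota\to o^+}}$, $(A\otimes B)^*=\lambda r.\exists p_1.\exists p_2.\langle r=p_1+p_2\rangle(A^*(p_1)\otimes B^*(p_2))$, $(A\parr B)^*=\overline{(A^\bot\otimes B^\bot)^*}$, $({\downarrow}A)^*=\lambda r.{\downarrow}A^*(r)$, $({\uparrow}A)^*=\overline{({\downarrow}A^\bot)^*}$. *Countdown machine.* A forcing command $\langle u^{\ominus}|t\rangle\{K\}=\langle u^\ominus|(t,K)\rangle$ consists of closed terms $t,u$ of opposite polarities and a closed term $K$, modulo $\langle u^\ominus|t\rangle\{K\}\equiv\langle t^\ominus|u\rangle\{K\}$;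 for a command $c=\langle t_+|u_-\rangle$, $c\{K\}$ denotes $\langle u_-^\ominus|t_+\rangle\{K\}$. Its reduction $\to_\bullet$ is: $\langle\mu\alpha.c|t_-\rangle\{\overline n\}\to_\bullet c[t_- /\alpha]\{\overline n\}$; $\langle V_+|\mu x.c\rangle\{\overline n\}\to_\bullet c[V_+/x]\{\overline n\}$; $\langle(V_1,V_2)|\mu(\kappa,\kappa').c\rangle\{\overline{n+1}\}\to_\bullet c[V_1/\kappa,V_2/\kappa']\{\overline n\}$; $\langle\{V\}|\mu\{\kappa\}.c\rangle\{\overline{n+1}\}\to_\bullet c[V/\kappa]\{\overline n\}$ (polarities matching). Let $\bot\!\!\!\bot^\bullet$ be a set of forcing commands closed under anti-$\to_\bullet$-evaluation. Let $|\cdot|^\bullet$ be the interpretation with weights in the trivial monoid $\{0\}$ (weights omitted from the notation) for the pole $\{\langle t_+|u_-\rangle:\langle u_-^\ominus|t_+\rangle\in\bot\!\!\!\bot^\bullet\}$, for a positive propositional domain $\mathcal D^\bullet$ containing all the sets $|\mathcal C[\cdot]|^\bullet(p)=\{\overline n:p\le n\}$, $p\in\mathbb N$, and for a total valuation $\rho^\bullet$.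 *Quantitative model.* Let $|\cdot|^\circ$ be the interpretation with weights in $(\mathbb N,+)$ for the pole $$\bot\!\!\!\bot^\circ=\{(c,p):\forall K\in|\mathcal C[\cdot]|^\bullet(p),\ c\{K\}\in\bot\!\!\!\bot^\bullet\},$$ the positive propositional domain $$\mathcal D^\circ=\{X:\exists\,Y\in(\mathcal D^\bullet)^{\mathbb N}\ \forall t,p\ \bigl((t,p)\in X\Leftrightarrow t\in Y(p)\bigr)\},$$ and any total valuation $\rho^\circ$ with $\rho^\circ(X^{o^+})=\{(t,p):t\in\rho^\bullet(X^{\iota\to o^+})(p)\}$ for every MAL variable $X$. **Connection lemma.** For every such $\bot\!\!\!\bot^\bullet$, $\mathcal D^\bullet$, $\rho^\bullet$, $\rho^\circ$, every MAL formula $C$, every closed term $t$ and every $p\in\mathbb N$, $$t\in|C^*(\bar p)|^\bullet_{\rho^\bullet}\iff(t,p)\in|C|^\circ_{\rho^\circ},\qquad \bar p={\bf s}^p{\bf 0}.$$ -/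

import Mathlib

namespace MALForcing

/-! ### Terms and commands of the focalising system L -/

/-- Polarities. -/
inductive Pol where
  | pos
  | neg
  deriving DecidableEq

/-- The opposite polarity. -/
def Pol.dual : Pol → Pol
  | .pos => .neg
  | .neg => .pos

/-- Syntactic categories: values of a given polarity, positive terms, commands. There is no
separate category of negative terms, because negative terms and negative values coincide. -/
inductive Cat where
  | val (a : Pol)
  | pterm
  | cmd

/-- Well-scoped de Bruijn variables of polarity `a` in a context. -/
inductive Var : List Pol → Pol → Type where
  | here {Γ : List Pol} {a : Pol} : Var (a :: Γ) a
  | there {Γ : List Pol} {a b : Pol} : Var Γ a → Var (b :: Γ) a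

/-- The term syntax, up to alpha-equivalence, with free variables in the context; `Kp` and `Kn` are
the sets of positive and negative instructions. Commands `⟨t₊|t₋⟩ = ⟨t₋|t₊⟩` are written with the
positive term first. -/
inductive Expr (Kp Kn : Type) : List Pol → Cat → Type where
  /-- a positive variable `x` or a negative variable `α` -/
  | var {Γ : List Pol} {a : Pol} : Var Γ a → Expr Kp Kn Γ (.val a)
  /-- the pair `(V, V')` -/
  | pair {Γ : List Pol} {a b : Pol} :
      Expr Kp Kn Γ (.val a) → Expr Kp Kn Γ (.val b) → Expr Kp Kn Γ (.val .pos)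
  /-- the one-tuple `{V}` -/
  | one {Γ : List Pol} {a : Pol} : Expr Kp Kn Γ (.val a) → Expr Kp Kn Γ (.val .pos)
  | pconst {Γ : List Pol} : Kp → Expr Kp Kn Γ (.val .pos)
  | nconst {Γ : List Pol} : Kn → Expr Kp Kn Γ (.val .neg)
  /-- positive values are positive terms -/
  | ofVal {Γ : List Pol} : Expr Kp Kn Γ (.val .pos) → Expr Kp Kn Γ .pterm
  /-- `μ α. c` -/
  | muNeg {Γ : List Pol} : Expr Kp Kn (.neg :: Γ) .cmd → Expr Kp Kn Γ .pterm
  /-- `μ x. c` -/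
  | muPos {Γ : List Pol} : Expr Kp Kn (.pos :: Γ) .cmd → Expr Kp Kn Γ (.val .neg)
  /-- `μ (κ, κ'). c` with `κ` of polarity `a` and `κ'` of polarity `b` -/
  | muPair {Γ : List Pol} (a b : Pol) :
      Expr Kp Kn (b :: a :: Γ) .cmd → Expr Kp Kn Γ (.val .neg)
  /-- `μ {κ}. c` with `κ` of polarity `a` -/
  | muOne {Γ : List Pol} (a : Pol) : Expr Kp Kn (a :: Γ) .cmd → Expr Kp Kn Γ (.val .neg)
  /-- the command `⟨t₊|t₋⟩` -/
  | cut {Γ : List Pol} : Expr Kp Kn Γ .pterm → Expr Kp Kn Γ (.val .neg) → Expr Kp Kn Γ .cmd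

/-- Lift a renaming under a binder. -/
def liftRen {Γ Δ : List Pol} {b : Pol} (f : ∀ a, Var Γ a → Var Δ a) :
    ∀ a, Var (b :: Γ) a → Var (b :: Δ) a
  | _, .here => .here
  | _, .there v => .there (f _ v)

/-- Renaming of variables. -/
def Expr.rename {Kp Kn : Type} : ∀ {Γ Δ : List Pol} {s : Cat},
    (∀ a, Var Γ a → Var Δ a) → Expr Kp Kn Γ s → Expr Kp Kn Δ s
  | _, _, _, f, .var v => .var (f _ v)
  | _, _, _, f, .pair v w => .pair (v.rename f) (w.rename f)
  | _, _, _, f, .one v => .one (v.rename f)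
  | _, _, _, _, .pconst k => .pconst k
  | _, _, _, _, .nconst k => .nconst k
  | _, _, _, f, .ofVal v => .ofVal (v.rename f)
  | _, _, _, f, .muNeg c => .muNeg (c.rename (liftRen f))
  | _, _, _, f, .muPos c => .muPos (c.rename (liftRen f))
  | _, _, _, f, .muPair a b c => .muPair a b (c.rename (liftRen (liftRen f)))
  | _, _, _, f, .muOne a c => .muOne a (c.rename (liftRen f))
  | _, _, _, f, .cut t u => .cut (t.rename f) (u.rename f)

/-- Lift a substitution under a binder. -/
def liftSub {Kp Kn : Type} {Γ Δ : List Pol} {b : Pol}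
    (f : ∀ a, Var Γ a → Expr Kp Kn Δ (.val a)) :
    ∀ a, Var (b :: Γ) a → Expr Kp Kn (b :: Δ) (.val a)
  | _, .here => .var .here
  | _, .there v => (f _ v).rename fun _ w => .there w

/-- Capture-avoiding simultaneous substitution of values of the right polarity for variables. -/
def Expr.subst {Kp Kn : Type} : ∀ {Γ Δ : List Pol} {s : Cat},
    (∀ a, Var Γ a → Expr Kp Kn Δ (.val a)) → Expr Kp Kn Γ s → Expr Kp Kn Δ s
  | _, _, _, f, .var v => f _ v
  | _, _, _, f, .pair v w => .pair (v.subst f) (w.subst f)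
  | _, _, _, f, .one v => .one (v.subst f)
  | _, _, _, _, .pconst k => .pconst k
  | _, _, _, _, .nconst k => .nconst k
  | _, _, _, f, .ofVal v => .ofVal (v.subst f)
  | _, _, _, f, .muNeg c => .muNeg (c.subst (liftSub f))
  | _, _, _, f, .muPos c => .muPos (c.subst (liftSub f))
  | _, _, _, f, .muPair a b c => .muPair a b (c.subst (liftSub (liftSub f)))
  | _, _, _, f, .muOne a c => .muOne a (c.subst (liftSub f))
  | _, _, _, f, .cut t u => .cut (t.subst f) (u.subst f)

/-- Closed values of polarity `a`; `CVal Kp Kn .neg` is the set of all closed negative terms. -/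
abbrev CVal (Kp Kn : Type) (a : Pol) : Type := Expr Kp Kn [] (.val a)

/-- Closed positive terms. -/
abbrev CPTerm (Kp Kn : Type) : Type := Expr Kp Kn [] .pterm

/-- Closed commands. -/
abbrev CCmd (Kp Kn : Type) : Type := Expr Kp Kn [] .cmd

/-- Closed terms, of either polarity. -/
inductive CTerm (Kp Kn : Type) : Type where
  | pos : CPTerm Kp Kn → CTerm Kp Kn
  | neg : CVal Kp Kn .neg → CTerm Kp Kn

/-- A closed value seen as a closed term. -/
def toTerm {Kp Kn : Type} : {a : Pol} → CVal Kp Kn a → CTerm Kp Kn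
  | .pos, v => .pos (.ofVal v)
  | .neg, t => .neg t

/-- The substitution of a closed value for the only free variable. -/
def sub₁ {Kp Kn : Type} {a : Pol} (v : CVal Kp Kn a) :
    ∀ b, Var [a] b → Expr Kp Kn [] (.val b)
  | _, .here => v

/-- The substitution of `v` for `κ` and `w` for `κ'` in the body of `μ (κ, κ'). c`. -/
def sub₂ {Kp Kn : Type} {a a' : Pol} (v : CVal Kp Kn a) (w : CVal Kp Kn a') :
    ∀ b, Var [a', a] b → Expr Kp Kn [] (.val b)
  | _, .here => w
  | _, .there .here => v

/-! ### Quantitative poles, orthogonality and propositional domains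

The order and the norm of a quantitative monoid play no role in the interpretation of formulas, so
that only its addition is mentioned. -/

section Realizability

variable {Kp Kn M : Type} [AddCommMonoid M]

/-- The orthogonal, for the pole `bot`, of a set of weighted closed positive values. -/
def orth (bot : Set (CCmd Kp Kn × M)) (X : Set (CVal Kp Kn .pos × M)) :
    Set (CVal Kp Kn .neg × M) :=
  {t | ∀ v ∈ X, (Expr.cut (.ofVal v.1) t.1, v.2 + t.2) ∈ bot}

/-- `X ⊗ Y`. -/
def tensorSet {a b : Pol} (X : Set (CVal Kp Kn a × M)) (Y : Set (CVal Kp Kn b × M)) :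
    Set (CVal Kp Kn .pos × M) :=
  {z | ∃ x ∈ X, ∃ y ∈ Y, z = (Expr.pair x.1 y.1, x.2 + y.2)}

/-- `↓ X`. -/
def downSet {a : Pol} (X : Set (CVal Kp Kn a × M)) : Set (CVal Kp Kn .pos × M) :=
  {z | ∃ x ∈ X, z = (Expr.one x.1, x.2)}

/-- For a set `D` of sets of weighted positive values, `D⁺ = D` and `D⁻ = {X^⊥ | X ∈ D}`. -/
def polDom (bot : Set (CCmd Kp Kn × M)) (D : Set (Set (CVal Kp Kn .pos × M))) :
    (a : Pol) → Set (Set (CVal Kp Kn a × M))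
  | .pos => D
  | .neg => orth bot '' D

/-- Positive propositional domains for the pole `bot`: closed under unions of arbitrary families,
intersections of nonempty families, `⊗` and `↓`. -/
structure PropDomain (bot : Set (CCmd Kp Kn × M)) where
  carrier : Set (Set (CVal Kp Kn .pos × M))
  sUnion_mem : ∀ S ⊆ carrier, ⋃₀ S ∈ carrier
  sInter_mem : ∀ S ⊆ carrier, S.Nonempty → ⋂₀ S ∈ carrier
  tensor_mem : ∀ (a b : Pol), ∀ X ∈ polDom bot carrier a, ∀ Y ∈ polDom bot carrier b,
    tensorSet X Y ∈ carrier
  down_mem : ∀ (a : Pol), ∀ X ∈ polDom bot carrier a, downSet X ∈ carrier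

end Realizability

/-! ### Kinds and type constructors -/

/-- Kinds: individuals, positive and negative formulas, functions. -/
inductive Kind where
  | ind
  | o (a : Pol)
  | arr (σ τ : Kind)
  deriving DecidableEq

/-- Negation of kinds. -/
def Kind.dual : Kind → Kind
  | .ind => .ind
  | .o a => .o a.dual
  | .arr σ τ => .arr σ τ.dual

theorem Kind.dual_dual : ∀ σ : Kind, σ.dual.dual = σ
  | .ind => rfl
  | .o .pos => rfl
  | .o .neg => rfl
  | .arr σ τ => congrArg (Kind.arr σ) τ.dual_dual

/-- The kind of the recursor with result kind `τ'`. -/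
abbrev Kind.recKind (τ τ' : Kind) : Kind :=
  .arr τ (.arr (.arr .ind (.arr τ τ)) (.arr .ind τ'))

/-- Well-kinded type constructors, with named variables `x^σ` (a natural number together with a
kind). The parameter `P` is a set of additional constants of kind `ι → o⁺`. -/
inductive Con (P : Type) : Kind → Type where
  | var (x : ℕ) (σ : Kind) : Con P σ
  /-- the dual variable `(x^σ)^⊥` -/
  | dvar (x : ℕ) (σ : Kind) : Con P σ.dual
  | lam (x : ℕ) (σ : Kind) {τ : Kind} (T : Con P τ) : Con P (.arr σ τ)
  | app {σ τ : Kind} (T : Con P (.arr σ τ)) (U : Con P σ) : Con P τ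
  | zero : Con P .ind
  | succ : Con P (.arr .ind .ind)
  | recur (τ : Kind) : Con P (.recKind τ τ)
  /-- the dual recursor -/
  | drecur (τ : Kind) : Con P (.recKind τ τ.dual)
  | tensor {a b : Pol} (A : Con P (.o a)) (B : Con P (.o b)) : Con P (.o .pos)
  | par {a b : Pol} (A : Con P (.o a)) (B : Con P (.o b)) : Con P (.o .neg)
  | ex (x : ℕ) (σ : Kind) {a : Pol} (A : Con P (.o a)) : Con P (.o a)
  | all (x : ℕ) (σ : Kind) {a : Pol} (A : Con P (.o a)) : Con P (.o a)
  | down {a : Pol} (A : Con P (.o a)) : Con P (.o .pos)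
  | up {a : Pol} (A : Con P (.o a)) : Con P (.o .neg)
  /-- the equational construct `⟨T = U⟩ A`: it is `A` if `T` and `U` are equal, and otherwise the
  empty formula for positive `A` and the orthogonal of the empty formula for negative `A` -/
  | eqn {σ : Kind} (T U : Con P σ) {a : Pol} (A : Con P (.o a)) : Con P (.o a)
  | pred (c : P) : Con P (.arr .ind (.o .pos))
  | dpred (c : P) : Con P (.arr .ind (.o .neg))

namespace Con

variable {P : Type}

/-- Involutive negation of constructors. -/
def neg : {σ : Kind} → Con P σ → Con P σ.dual
  | _, .var x σ => .dvar x σ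
  | _, .dvar x σ => cast (congrArg (Con P) σ.dual_dual.symm) (.var x σ)
  | _, .lam x σ T => .lam x σ T.neg
  | _, .app T U => .app T.neg U
  | _, .zero => .zero
  | _, .succ => .succ
  | _, .recur τ => .drecur τ
  | _, .drecur τ => cast (congrArg (fun τ' => Con P (.recKind τ τ')) τ.dual_dual.symm) (.recur τ)
  | _, .tensor A B => .par A.neg B.neg
  | _, .par A B => .tensor A.neg B.neg
  | _, .ex x σ A => .all x σ A.neg
  | _, .all x σ A => .ex x σ A.neg
  | _, .down A => .up A.neg
  | _, .up A => .down A.neg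
  | _, .eqn T U A => .eqn T U A.neg
  | _, .pred c => .dpred c
  | _, .dpred c => .pred c

/-- The size of a constructor. -/
def size : {σ : Kind} → Con P σ → ℕ
  | _, .lam _ _ T => T.size + 1
  | _, .app T U => T.size + U.size + 1
  | _, .tensor A B => A.size + B.size + 1
  | _, .par A B => A.size + B.size + 1
  | _, .ex _ _ A => A.size + 1
  | _, .all _ _ A => A.size + 1
  | _, .down A => A.size + 1
  | _, .up A => A.size + 1
  | _, .eqn T U A => T.size + U.size + A.size + 1
  | _, _ => 1

theorem size_cast {σ τ : Kind} (h : σ = τ) (T : Con P σ) :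
    (cast (congrArg (Con P) h) T).size = T.size := by
  subst h; rfl

theorem size_neg {σ : Kind} (T : Con P σ) : T.neg.size = T.size := by
  induction T with
  | dvar x σ =>
    rw [neg]
    exact (size_cast σ.dual_dual.symm _).trans (by simp [size])
  | drecur τ =>
    rw [neg]
    exact (size_cast (congrArg (Kind.recKind τ) τ.dual_dual.symm) _).trans (by simp [size])
  | var | zero | succ | recur | pred | dpred => simp [neg, size]
  | lam _ _ _ ih | ex _ _ _ ih | all _ _ _ ih | down _ ih | up _ ih =>
    exact congrArg (· + 1) ih
  | app T U ih _ => exact congrArg (· + U.size + 1) ih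
  | tensor _ _ ihA ihB | par _ _ ihA ihB => exact congrArg₂ (· + · + 1) ihA ihB
  | eqn T U _ _ _ ih => exact congrArg (T.size + U.size + · + 1) ih

theorem size_neg_formula {a : Pol} (A : Con P (.o a)) : size (σ := .o a.dual) A.neg = A.size :=
  size_neg A

/-- A natural number strictly larger than all the names of variables in a constructor. -/
def fresh : {σ : Kind} → Con P σ → ℕ
  | _, .var x _ => x + 1
  | _, .dvar x _ => x + 1
  | _, .lam x _ T => max (x + 1) T.fresh
  | _, .app T U => max T.fresh U.fresh
  | _, .tensor A B => max A.fresh B.fresh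
  | _, .par A B => max A.fresh B.fresh
  | _, .ex x _ A => max (x + 1) A.fresh
  | _, .all x _ A => max (x + 1) A.fresh
  | _, .down A => A.fresh
  | _, .up A => A.fresh
  | _, .eqn T U A => max (max T.fresh U.fresh) A.fresh
  | _, _ => 0

/-- The constructor `sⁿ 0`. -/
def numeral : ℕ → Con P .ind
  | 0 => .zero
  | n + 1 => .app .succ (numeral n)

/-- Linear implication `A ⊸ B = A^⊥ ⅋ B`. -/
def lolli {a b : Pol} (A : Con P (.o a)) (B : Con P (.o b)) : Con P (.o .neg) :=
  .par (a := a.dual) A.neg B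

/-- Addition of individuals, `λ p. λ q. rec p (λ n. s) q`. -/
def plus : Con P (.arr .ind (.arr .ind .ind)) :=
  .lam 0 .ind (.lam 1 .ind
    (.app (.app (.app (.recur .ind) (.var 0 .ind)) (.lam 2 .ind .succ)) (.var 1 .ind)))

/-- `T + U`. -/
def add (T U : Con P .ind) : Con P .ind := .app (.app plus T) U

end Con

/-! ### Interpretation of kinds and constructors -/

namespace PropDomain

variable {Kp Kn M : Type} [AddCommMonoid M] {bot : Set (CCmd Kp Kn × M)} (D : PropDomain bot)

theorem empty_mem : ∅ ∈ D.carrier := by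
  simpa using D.sUnion_mem ∅ (Set.empty_subset _)

/-- The interpretation of kinds. -/
def Sem : Kind → Type
  | .ind => ℕ
  | .o a => {X : Set (CVal Kp Kn a × M) // X ∈ polDom bot D.carrier a}
  | .arr σ τ => Sem σ → Sem τ

/-- The orthogonality map from the interpretation of `o⁺` to the interpretation of `o⁻`. -/
def orthSem (X : D.Sem (.o .pos)) : D.Sem (.o .neg) := ⟨orth bot X.1, X.1, X.2, rfl⟩

/-- The empty set in the interpretation of `o⁺`, its orthogonal in the interpretation of `o⁻`. -/
def emptySem : (a : Pol) → D.Sem (.o a)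
  | .pos => ⟨∅, D.empty_mem⟩
  | .neg => D.orthSem ⟨∅, D.empty_mem⟩

theorem nonempty_sem : ∀ σ : Kind, Nonempty (D.Sem σ)
  | .ind => ⟨(0 : ℕ)⟩
  | .o a => ⟨D.emptySem a⟩
  | .arr σ τ => by
    obtain ⟨y⟩ := nonempty_sem τ
    exact ⟨fun (_ : D.Sem σ) => y⟩

/-- The operation `⊥(·, σ)`. An element of the interpretation of `o⁻` is the orthogonal of some
element of the domain, which is returned. -/
noncomputable def bott : (σ : Kind) → D.Sem σ → D.Sem σ.dual
  | .ind, n => n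
  | .o .pos, X => D.orthSem X
  | .o .neg, X => ⟨X.2.choose, X.2.choose_spec.1⟩
  | .arr _ τ, F => fun v => bott τ (F v)

/-- `X ⊗ Y` in the interpretation of `o⁺`. -/
def tensorSem {a b : Pol} (X : D.Sem (.o a)) (Y : D.Sem (.o b)) : D.Sem (.o .pos) :=
  ⟨tensorSet X.1 Y.1, D.tensor_mem a b X.1 X.2 Y.1 Y.2⟩

/-- `↓ X` in the interpretation of `o⁺`. -/
def downSem {a : Pol} (X : D.Sem (.o a)) : D.Sem (.o .pos) :=
  ⟨downSet X.1, D.down_mem a X.1 X.2⟩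

/-- Unions of families in the interpretation of `o⁺`. -/
def unionSem {ι : Type} (F : ι → D.Sem (.o .pos)) : D.Sem (.o .pos) :=
  ⟨⋃ v, (F v).1, D.sUnion_mem _ (by rintro _ ⟨v, rfl⟩; exact (F v).2)⟩

/-- Intersections of nonempty families in the interpretation of `o⁺`. -/
def interSem {ι : Type} [h : Nonempty ι] (F : ι → D.Sem (.o .pos)) : D.Sem (.o .pos) :=
  ⟨⋂ v, (F v).1, D.sInter_mem _ (by rintro _ ⟨v, rfl⟩; exact (F v).2)
    (h.elim fun v => ⟨_, v, rfl⟩)⟩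

/-- Existential quantification of a family `F`, where `G` is the family of the negations: the union
for positive families, the orthogonal of the intersection of the negations for negative ones. -/
def exSem {ι : Type} [Nonempty ι] : (a : Pol) → (F : ι → D.Sem (.o a)) →
    (G : ι → D.Sem (.o a.dual)) → D.Sem (.o a)
  | .pos, F, _ => D.unionSem F
  | .neg, _, G => D.orthSem (D.interSem G)

/-- Universal quantification of a family `F`, where `G` is the family of the negations: the
intersection for positive families, the orthogonal of the union of the negations for negative
ones. -/
def allSem {ι : Type} [Nonempty ι] : (a : Pol) → (F : ι → D.Sem (.o a)) →
    (G : ι → D.Sem (.o a.dual)) → D.Sem (.o a)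
  | .pos, F, _ => D.interSem F
  | .neg, _, G => D.orthSem (D.unionSem G)

/-- Total valuations. -/
def Valuation : Type := (x : ℕ) → (σ : Kind) → D.Sem σ

/-- The valuation `ρ[x^σ ← v]`. -/
def update {D : PropDomain bot} (ρ : D.Valuation) (x : ℕ) (σ : Kind) (v : D.Sem σ) : D.Valuation :=
  fun y τ => if h : x = y ∧ σ = τ then cast (congrArg D.Sem h.2) v else ρ y τ

open Classical in
/-- The interpretation of constructors, for an interpretation `I` of the additional constants. -/
noncomputable def interp {P : Type} (I : P → ℕ → D.Sem (.o .pos)) :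
    {σ : Kind} → Con P σ → D.Valuation → D.Sem σ
  | _, .var x σ, ρ => ρ x σ
  | _, .dvar x σ, ρ => D.bott σ (ρ x σ)
  | _, .lam x σ T, ρ => fun v => interp I T (update ρ x σ v)
  | _, .app T U, ρ => (interp I T ρ) (interp I U ρ)
  | _, .zero, _ => (0 : ℕ)
  | _, .succ, _ => fun n : ℕ => n + 1
  | _, .recur τ, _ => fun t (u : ℕ → D.Sem τ → D.Sem τ) (n : ℕ) =>
      Nat.rec (motive := fun _ => D.Sem τ) t u n
  | _, .drecur τ, _ => fun t (u : ℕ → D.Sem τ → D.Sem τ) (n : ℕ) =>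
      D.bott τ (Nat.rec (motive := fun _ => D.Sem τ) t u n)
  | _, .tensor A B, ρ => D.tensorSem (interp I A ρ) (interp I B ρ)
  | _, .par (a := a) (b := b) A B, ρ => D.orthSem
      (D.tensorSem (a := a.dual) (b := b.dual) (interp I A.neg ρ) (interp I B.neg ρ))
  | _, .ex x σ (a := a) A, ρ =>
      haveI := D.nonempty_sem σ
      D.exSem a (fun v => interp I A (update ρ x σ v)) fun v => interp I A.neg (update ρ x σ v)
  | _, .all x σ (a := a) A, ρ =>
      haveI := D.nonempty_sem σ
      D.allSem a (fun v => interp I A (update ρ x σ v)) fun v => interp I A.neg (update ρ x σ v)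
  | _, .down A, ρ => D.downSem (interp I A ρ)
  | _, .up (a := a) A, ρ => D.orthSem (D.downSem (a := a.dual) (interp I A.neg ρ))
  | _, .eqn (a := a) T U A, ρ =>
      if interp I T ρ = interp I U ρ then interp I A ρ else D.emptySem a
  | _, .pred c, _ => fun n : ℕ => I c n
  | _, .dpred c, _ => fun n : ℕ => D.orthSem (I c n)
  termination_by _ T => T.size
  decreasing_by all_goals simp only [Con.size, Con.size_neg_formula]; omega

/-- The interpretation of a formula, as a set of weighted closed terms. -/
noncomputable def den {P : Type} (I : P → ℕ → D.Sem (.o .pos)) {a : Pol} (A : Con P (.o a))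
    (ρ : D.Valuation) : Set (CTerm Kp Kn × M) :=
  (fun x => (toTerm x.1, x.2)) '' (D.interp I A ρ).1

end PropDomain

/-! ### Formulas of multiplicative affine logic and the forcing translation -/

/-- MAL formulas of a given polarity. -/
inductive MAL : Pol → Type where
  | var (X : ℕ) : MAL .pos
  | dvar (X : ℕ) : MAL .neg
  | tensor {a b : Pol} (A : MAL a) (B : MAL b) : MAL .pos
  | par {a b : Pol} (A : MAL a) (B : MAL b) : MAL .neg
  | down {a : Pol} (A : MAL a) : MAL .pos
  | up {a : Pol} (A : MAL a) : MAL .neg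

namespace MAL

/-- Negation of MAL formulas. -/
def neg : {a : Pol} → MAL a → MAL a.dual
  | _, .var X => .dvar X
  | _, .dvar X => .var X
  | _, .tensor A B => .par A.neg B.neg
  | _, .par A B => .tensor A.neg B.neg
  | _, .down A => .up A.neg
  | _, .up A => .down A.neg

/-- The size of a MAL formula. -/
def size : {a : Pol} → MAL a → ℕ
  | _, .var _ => 1
  | _, .dvar _ => 1
  | _, .tensor A B => A.size + B.size + 1
  | _, .par A B => A.size + B.size + 1
  | _, .down A => A.size + 1
  | _, .up A => A.size + 1

theorem size_neg {a : Pol} (A : MAL a) : A.neg.size = A.size := by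
  induction A <;> simp_all [neg, size]

/-- A MAL formula seen as a constructor. The variable associated with `X` is `X^{o⁺}`. -/
def toCon : {a : Pol} → MAL a → Con Empty (.o a)
  | _, .var X => .var X (.o .pos)
  | _, .dvar X => .dvar X (.o .pos)
  | _, .tensor A B => .tensor A.toCon B.toCon
  | _, .par A B => .par A.toCon B.toCon
  | _, .down A => .down A.toCon
  | _, .up A => .up A.toCon

end MAL

/-- The new predicate `𝒞[·]` on conditions, of kind `ι → o⁺`. -/
def condPred (T : Con Unit .ind) : Con Unit (.o .pos) := .app (.pred ()) T

/-- The forcing orthogonal `λ r. ∀ r'. Z(r') ⊸ 𝒞[r + r']^⊥`, with `r`, `r'` not occurring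
in `Z`. -/
def forcOrtho {a : Pol} (Z : Con Unit (.arr .ind (.o a))) : Con Unit (.arr .ind (.o .neg)) :=
  let r := Z.fresh
  let r' := Z.fresh + 1
  .lam r .ind (.all r' .ind
    (Con.lolli (.app Z (.var r' .ind))
      (b := .neg) (condPred (Con.add (.var r .ind) (.var r' .ind))).neg))

/-- `λ r. ∃ p₁. ∃ p₂. ⟨r = p₁ + p₂⟩ (Z(p₁) ⊗ W(p₂))`, with `r`, `p₁`, `p₂` not occurring
in `Z`, `W`. -/
def forcTensor {a b : Pol} (Z : Con Unit (.arr .ind (.o a))) (W : Con Unit (.arr .ind (.o b))) :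
    Con Unit (.arr .ind (.o .pos)) :=
  let r := max Z.fresh W.fresh
  let p₁ := r + 1
  let p₂ := r + 2
  .lam r .ind (.ex p₁ .ind (.ex p₂ .ind
    (.eqn (.var r .ind) (Con.add (.var p₁ .ind) (.var p₂ .ind))
      (.tensor (.app Z (.var p₁ .ind)) (.app W (.var p₂ .ind))))))

/-- `λ r. ↓ Z(r)`, with `r` not occurring in `Z`. -/
def forcDown {a : Pol} (Z : Con Unit (.arr .ind (.o a))) : Con Unit (.arr .ind (.o .pos)) :=
  .lam Z.fresh .ind (.down (.app Z (.var Z.fresh .ind)))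

/-- The forcing translation `A*`. The variable associated with `X` is `X^{ι → o⁺}`. -/
def MAL.star : {a : Pol} → MAL a → Con Unit (.arr .ind (.o a))
  | _, .var X => .var X (.arr .ind (.o .pos))
  | _, .dvar X => forcOrtho (.var X (.arr .ind (.o .pos)))
  | _, .tensor A B => forcTensor A.star B.star
  | _, .par A B => forcOrtho (forcTensor A.neg.star B.neg.star)
  | _, .down A => forcDown A.star
  | _, .up A => forcOrtho (forcDown A.neg.star)
  termination_by _ A => A.size
  decreasing_by all_goals simp only [MAL.size, MAL.size_neg]; omega

/-! ### The countdown machine -/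

/-- Forcing commands `⟨u₋^⊖|t₊⟩{K} = ⟨u₋^⊖|(t₊, K)⟩`, modulo their identification with
`⟨t₊^⊖|u₋⟩{K}`. -/
structure ForcingCmd (Kp Kn : Type) where
  pos : CPTerm Kp Kn
  neg : CVal Kp Kn .neg
  counter : CTerm Kp Kn

/-- The forcing command `c{K}` built from a command `c` and a term `K`. -/
def forcCmd {Kp Kn : Type} : CCmd Kp Kn → CTerm Kp Kn → ForcingCmd Kp Kn
  | .cut t u, K => ⟨t, u, K⟩

section Countdown

variable {Kp Kn : Type} (num : ℕ ↪ Kp)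

/-- The primitive integer, as a closed positive value. -/
def numVal (n : ℕ) : CVal Kp Kn .pos := .pconst (num n)

/-- The reduction relation of the countdown machine. When the counter is `0`, commands that would
perform a beta step diverge: they have no successor. -/
inductive CountdownStep : ForcingCmd Kp Kn → ForcingCmd Kp Kn → Prop where
  | muNeg (c : Expr Kp Kn [.neg] .cmd) (t : CVal Kp Kn .neg) (n : ℕ) :
      CountdownStep ⟨.muNeg c, t, toTerm (numVal num n)⟩
        (forcCmd (c.subst (sub₁ t)) (toTerm (numVal num n)))
  | muPos (c : Expr Kp Kn [.pos] .cmd) (v : CVal Kp Kn .pos) (n : ℕ) :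
      CountdownStep ⟨.ofVal v, .muPos c, toTerm (numVal num n)⟩
        (forcCmd (c.subst (sub₁ v)) (toTerm (numVal num n)))
  | pair (a b : Pol) (c : Expr Kp Kn [b, a] .cmd) (v : CVal Kp Kn a) (w : CVal Kp Kn b) (n : ℕ) :
      CountdownStep ⟨.ofVal (.pair v w), .muPair a b c, toTerm (numVal num (n + 1))⟩
        (forcCmd (c.subst (sub₂ v w)) (toTerm (numVal num n)))
  | one (a : Pol) (c : Expr Kp Kn [a] .cmd) (v : CVal Kp Kn a) (n : ℕ) :
      CountdownStep ⟨.ofVal (.one v), .muOne a c, toTerm (numVal num (n + 1))⟩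
        (forcCmd (c.subst (sub₁ v)) (toTerm (numVal num n)))

variable (Kn) in
/-- A set of forcing commands that is closed under anti-evaluation. -/
structure CountdownPole where
  carrier : Set (ForcingCmd Kp Kn)
  anti : ∀ c c', CountdownStep num c c' → c' ∈ carrier → c ∈ carrier

variable {num}

/-- The set of ordinary commands `⟨(V, K)|t₋⟩` such that the forcing command
`⟨t₋^⊖|(V, K)⟩` is in the pole, weighted in the trivial monoid. Only pairs of values are needed,
because orthogonals are taken of sets of values. -/
def CountdownPole.simple (B : CountdownPole Kn num) : Set (CCmd Kp Kn × Unit) :=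
  {c | ∃ (a : Pol) (v : CVal Kp Kn .pos) (K : CVal Kp Kn a) (t : CVal Kp Kn .neg),
    c.1 = .cut (.ofVal (.pair v K)) t ∧ (⟨.ofVal v, t, toTerm K⟩ : ForcingCmd Kp Kn) ∈ B.carrier}

variable (Kn num) in
/-- The interpretation of `𝒞[p]`: the primitive integers that are at least `p`. -/
def condSet (p : ℕ) : Set (CVal Kp Kn .pos × Unit) :=
  {K | ∃ n : ℕ, p ≤ n ∧ K = (numVal num n, ())}

/-- The quantitative pole: weighted commands `(c, p)` such that `c{K}` is in the countdown pole for
every `K` in the interpretation of `𝒞[p]`. -/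
def CountdownPole.quant (B : CountdownPole Kn num) : Set (CCmd Kp Kn × ℕ) :=
  {c | ∀ K ∈ condSet Kn num c.2, forcCmd c.1 (toTerm K.1) ∈ B.carrier}

end Countdown

/-! ### The quantitative domain and valuation -/

section Quantitative

variable {Kp Kn : Type} {num : ℕ ↪ Kp} {B : CountdownPole Kn num}

/-- The sets `X` of weighted values such that `(t, p) ∈ X ↔ t ∈ Y p` for some sequence `Y` of
elements of the domain. -/
def quantCarrier (D : PropDomain B.simple) : Set (Set (CVal Kp Kn .pos × ℕ)) :=
  {X | ∃ Y : ℕ → Set (CVal Kp Kn .pos × Unit), (∀ p, Y p ∈ D.carrier) ∧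
    ∀ t p, (t, p) ∈ X ↔ (t, ()) ∈ Y p}

/-- The elements of weight `p`. -/
def slice {a : Pol} (X : Set (CVal Kp Kn a × ℕ)) (p : ℕ) : Set (CVal Kp Kn a × Unit) :=
  {x | (x.1, p) ∈ X}

theorem mem_quantCarrier (D : PropDomain B.simple) (X : Set (CVal Kp Kn .pos × ℕ)) :
    X ∈ quantCarrier D ↔ ∀ p, slice X p ∈ D.carrier := by
  constructor
  · rintro ⟨Y, hY, h⟩ p
    have : slice X p = Y p := by
      ext ⟨t, _⟩
      exact h t p
    exact this ▸ hY p
  · intro h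
    exact ⟨slice X, h, fun _ _ => Iff.rfl⟩

theorem slice_mem (D : PropDomain B.simple) (hD : ∀ p, condSet Kn num p ∈ D.carrier) :
    ∀ (a : Pol), ∀ X ∈ polDom B.quant (quantCarrier D) a, ∀ p,
      slice X p ∈ polDom B.simple D.carrier a
  | .pos, X, hX, p => (mem_quantCarrier D X).1 hX p
  | .neg, _, ⟨Z, hZ, rfl⟩, p => by
    refine ⟨⋃₀ (Set.range fun r => tensorSet (slice Z r) (condSet Kn num (r + p))), ?_, ?_⟩
    · refine D.sUnion_mem _ ?_
      rintro _ ⟨r, rfl⟩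
      exact D.tensor_mem .pos .pos _ ((mem_quantCarrier D Z).1 hZ r) _ (hD _)
    · ext ⟨t, u⟩
      constructor
      · rintro h ⟨v, r⟩ hv _ ⟨n, hn, rfl⟩
        obtain ⟨a, v', K, t', h1, h2⟩ := h (Expr.pair v (numVal num n), ())
          ⟨_, ⟨r, rfl⟩, (v, ()), hv, (numVal num n, ()), ⟨n, hn, rfl⟩, rfl⟩
        simp only [Expr.cut.injEq, Expr.ofVal.injEq, Expr.pair.injEq] at h1
        obtain ⟨⟨-, rfl, h3, h4⟩, rfl⟩ := h1
        obtain rfl := eq_of_heq h3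
        obtain rfl := eq_of_heq h4
        exact h2
      · rintro h ⟨w, _⟩ ⟨_, ⟨r, rfl⟩, ⟨v, _⟩, hv, _, ⟨n, hn, rfl⟩, hw⟩
        obtain ⟨rfl, -⟩ := Prod.mk.inj hw
        exact ⟨.pos, v, numVal num n, t, rfl, h (v, r) hv _ ⟨n, hn, rfl⟩⟩

/-- The quantitative positive propositional domain induced by a domain that contains the
interpretations of `𝒞[p]`. -/
def quantDomain (D : PropDomain B.simple) (hD : ∀ p, condSet Kn num p ∈ D.carrier) :
    PropDomain B.quant where
  carrier := quantCarrier D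
  sUnion_mem S hS := by
    rw [mem_quantCarrier]
    intro p
    have : slice (⋃₀ S) p = ⋃₀ ((fun X => slice X p) '' S) := by
      ext x; simp [slice]
    rw [this]
    refine D.sUnion_mem _ ?_
    rintro _ ⟨X, hX, rfl⟩
    exact (mem_quantCarrier D X).1 (hS hX) p
  sInter_mem S hS hne := by
    rw [mem_quantCarrier]
    intro p
    have : slice (⋂₀ S) p = ⋂₀ ((fun X => slice X p) '' S) := by
      ext x; simp [slice]
    rw [this]
    refine D.sInter_mem _ ?_ (hne.image _)
    rintro _ ⟨X, hX, rfl⟩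
    exact (mem_quantCarrier D X).1 (hS hX) p
  tensor_mem a b X hX Y hY := by
    rw [mem_quantCarrier]
    intro p
    have : slice (tensorSet X Y) p =
        ⋃₀ {Z | ∃ q r, p = q + r ∧ Z = tensorSet (slice X q) (slice Y r)} := by
      ext ⟨z, u⟩
      constructor
      · rintro ⟨⟨x, q⟩, hx, ⟨y, r⟩, hy, h⟩
        obtain ⟨rfl, rfl⟩ := Prod.mk.inj h
        exact ⟨_, ⟨q, r, rfl, rfl⟩, (x, ()), hx, (y, ()), hy, rfl⟩
      · rintro ⟨_, ⟨q, r, rfl, rfl⟩, ⟨x, _⟩, hx, ⟨y, _⟩, hy, h⟩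
        obtain ⟨rfl, -⟩ := Prod.mk.inj h
        exact ⟨(x, q), hx, (y, r), hy, rfl⟩
    rw [this]
    refine D.sUnion_mem _ ?_
    rintro _ ⟨q, r, -, rfl⟩
    exact D.tensor_mem a b _ (slice_mem D hD a X hX q) _ (slice_mem D hD b Y hY r)
  down_mem a X hX := by
    rw [mem_quantCarrier]
    intro p
    have : slice (downSet X) p = downSet (slice X p) := by
      ext ⟨z, u⟩
      constructor
      · rintro ⟨⟨x, q⟩, hx, h⟩
        obtain ⟨rfl, rfl⟩ := Prod.mk.inj h
        exact ⟨(x, ()), hx, rfl⟩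
      · rintro ⟨⟨x, _⟩, hx, h⟩
        obtain ⟨rfl, -⟩ := Prod.mk.inj h
        exact ⟨(x, p), hx, rfl⟩
    rw [this]
    exact D.down_mem a _ (slice_mem D hD a X hX p)

/-- The quantitative interpretation of the MAL variable `X`: the set of the `(t, p)` such that
`t` belongs to the value at `p` of the valuation at `X^{ι → o⁺}`. -/
def rhoQuant {D : PropDomain B.simple} (ρ : D.Valuation) (X : ℕ) : Set (CVal Kp Kn .pos × ℕ) :=
  let F : ℕ → D.Sem (.o .pos) := ρ X (.arr .ind (.o .pos))
  {x | (x.1, ()) ∈ (F x.2).1}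

end Quantitative

end MALForcing

open MALForcing

/-! Everything reduces to comparing slices: the value of `C.star` at p is the set of elements of
weight p of the quantitative interpretation of C (`valueAt_star`). Three facts about slices carry
this. Weights add under ⊗, so the slice at p of a tensor is the union over p = q + r of tensors of
slices (`slice_tensorSet`). This is the reading of ∃p₁ ∃p₂ ⟨r = p₁ + p₂⟩ (`valueAt_forcTensor`). The
shift ↓ leaves weights alone (`slice_downSet`). For orthogonals, (t, p) is orthogonal to X when
⟨v|t⟩{n} is in the countdown pole for all (v, q) in X and all n ≥ p + q. But ⟨v|t⟩{n} is ⟨(v, n)|t⟩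
in the simple pole, so the slice at p of the orthogonal of X is the simple orthogonal of the union
over q of X_q ⊗ 𝒞[p + q] (`slice_orth`). The forcing orthogonal denotes the same set, since ∀r'.
Z(r') ⊸ 𝒞[r + r']^⊥ is the orthogonal of the union of the negated bodies Z(r') ⊗ 𝒞[r + r']
(`valueAt_forcOrtho`). The syntactic lemmas serve these computations: double negation disappears,
and the names bound by the translation are fresh. -/

namespace MALForcing

/-! ### Negation of constructors: involutivity and fresh names -/

namespace Con

variable {P : Type}

/-- Negating a dual variable or a dual recursor inserts a cast along `Kind.dual_dual`; this moves a
second negation past it. -/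
theorem neg_cast {σ τ : Kind} (h : σ = τ) (T : Con P σ) :
    HEq (cast (congrArg (Con P) h) T).neg T.neg := by
  subst h; rfl

theorem heq_lam {τ τ' : Kind} (h : τ = τ') {x : ℕ} {σ : Kind} {T : Con P τ} {T' : Con P τ'}
    (hT : HEq T T') : HEq (Con.lam x σ T) (Con.lam x σ T') := by
  subst h; cases hT; rfl

theorem heq_app {σ τ τ' : Kind} (h : τ = τ') {T : Con P (.arr σ τ)} {T' : Con P (.arr σ τ')}
    {U : Con P σ} (hT : HEq T T') : HEq (Con.app T U) (Con.app T' U) := by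
  subst h; cases hT; rfl

/-- Negation of constructors is involutive, up to the identification of `σ` with its bidual. -/
theorem neg_neg_heq {σ : Kind} (T : Con P σ) : HEq T.neg.neg T := by
  induction T with
  | var x σ => simp only [neg]; exact cast_heq _ _
  | dvar x σ =>
    rw [neg]
    exact (neg_cast σ.dual_dual.symm _).trans (by simp only [neg]; rfl)
  | recur τ =>
    simp only [neg]; exact cast_heq _ _
  | drecur τ =>
    rw [neg]
    exact (neg_cast (congrArg (Kind.recKind τ) τ.dual_dual.symm) _).trans
      (by simp only [neg]; rfl)
  | zero | succ | pred | dpred => simp only [neg]; rfl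
  | @lam x σ τ T ih => exact heq_lam τ.dual_dual ih
  | @app σ τ T U ih _ => exact heq_app τ.dual_dual ih
  | @tensor a b A B ihA ihB =>
    -- For a concrete polarity the bidual reduces to the polarity itself, so the heterogeneous
    -- equalities become ordinary ones.
    cases a <;> cases b <;> exact heq_of_eq (congrArg₂ Con.tensor (eq_of_heq ihA) (eq_of_heq ihB))
  | @par a b A B ihA ihB =>
    cases a <;> cases b <;> exact heq_of_eq (congrArg₂ Con.par (eq_of_heq ihA) (eq_of_heq ihB))
  | @ex x σ a A ih => cases a <;> exact heq_of_eq (congrArg (Con.ex x σ) (eq_of_heq ih))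
  | @all x σ a A ih => cases a <;> exact heq_of_eq (congrArg (Con.all x σ) (eq_of_heq ih))
  | @down a A ih => cases a <;> exact heq_of_eq (congrArg Con.down (eq_of_heq ih))
  | @up a A ih => cases a <;> exact heq_of_eq (congrArg Con.up (eq_of_heq ih))
  | @eqn σ T U a A _ _ ih => cases a <;> exact heq_of_eq (congrArg (Con.eqn T U) (eq_of_heq ih))

theorem fresh_cast {σ τ : Kind} (h : σ = τ) (T : Con P σ) :
    (cast (congrArg (Con P) h) T).fresh = T.fresh := by
  subst h; rfl

/-- Negation dualises constructors but never changes a name. This transfers freshness to the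
negations that occur in the interpretation of ⅋, ↑ and quantifiers. -/
theorem fresh_neg {σ : Kind} (T : Con P σ) : T.neg.fresh = T.fresh := by
  induction T with
  | dvar x σ =>
    rw [neg]
    exact (fresh_cast σ.dual_dual.symm _).trans (by simp [fresh])
  | drecur τ =>
    rw [neg]
    exact (fresh_cast (congrArg (Kind.recKind τ) τ.dual_dual.symm) _).trans (by simp [fresh])
  | var | zero | succ | recur | pred | dpred => simp [neg, fresh]
  | lam x _ _ ih | ex x _ _ ih | all x _ _ ih => exact congrArg (max (x + 1)) ih
  | down _ ih | up _ ih => exact ih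
  | app T U ih _ => exact congrArg (max · U.fresh) ih
  | tensor _ _ ihA ihB | par _ _ ihA ihB => exact congrArg₂ max ihA ihB
  | eqn T U _ _ _ ih => exact congrArg (max (max T.fresh U.fresh)) ih

end Con

/-- Reconciles the negation of MAL used by the forcing translation with the negation of constructors
used by the interpretation, in the cases of ⅋ and ↑. -/
theorem MAL.toCon_neg {a : Pol} (A : MAL a) : A.neg.toCon = A.toCon.neg := by
  induction A with
  | var | dvar => rfl
  | tensor _ _ ihA ihB => exact congrArg₂ Con.par ihA ihB
  | par _ _ ihA ihB => exact congrArg₂ Con.tensor ihA ihB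
  | down _ ih => exact congrArg Con.up ih
  | up _ ih => exact congrArg Con.down ih

/-! ### Dependence of the interpretation on the valuation -/

namespace PropDomain

variable {Kp Kn M : Type} [AddCommMonoid M] {bot : Set (CCmd Kp Kn × M)} {D : PropDomain bot}

theorem update_agree {ρ ρ' : D.Valuation} {N : ℕ} {x : ℕ} {σ : Kind} (v : D.Sem σ)
    (h : ∀ y < N, ∀ τ, ρ y τ = ρ' y τ) :
    ∀ y < N, ∀ τ, update ρ x σ v y τ = update ρ' x σ v y τ := by
  intro y hy τ
  unfold update
  split
  · rfl
  · exact h y hy τ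

theorem update_same (ρ : D.Valuation) (x : ℕ) (σ : Kind) (v : D.Sem σ) :
    update ρ x σ v x σ = v := by
  simp [update]

theorem update_of_ne (ρ : D.Valuation) {x y : ℕ} (σ τ : Kind) (v : D.Sem σ) (h : x ≠ y) :
    update ρ x σ v y τ = ρ y τ := by
  simp [update, h]

variable {P : Type} (I : P → ℕ → D.Sem (.o .pos))

/-- The interpretation of a constructor depends only on the variables below its fresh name. -/
theorem interp_congr (n : ℕ) : ∀ {σ : Kind} (T : Con P σ) (ρ ρ' : D.Valuation), T.size ≤ n →
    (∀ y < T.fresh, ∀ τ, ρ y τ = ρ' y τ) → D.interp I T ρ = D.interp I T ρ' := by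
  -- The induction is on a bound for the size, because ⅋, ↑ and the quantifiers interpret negations
  -- of components, which have the right size but are not subterms.
  induction n with
  | zero => intro σ T ρ ρ' h; cases T <;> simp [Con.size] at h
  | succ n ih =>
    intro σ T ρ ρ' hn h
    cases T <;> simp only [Con.size, Con.fresh, Nat.add_le_add_iff_right, lt_max_iff] at hn h
      <;> simp only [interp]
    case var x => exact h x (Nat.lt_succ_self x) σ
    case dvar x σ => rw [h x (Nat.lt_succ_self x) σ]
    case lam x σ τ T =>
      funext v
      exact ih T _ _ hn (update_agree v fun y hy => h y (.inr hy))
    case app σ U T =>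
      exact congr (ih T ρ ρ' (by omega) fun y hy => h y (.inl hy))
        (ih U ρ ρ' (by omega) fun y hy => h y (.inr hy))
    case tensor A B =>
      rw [ih A ρ ρ' (by omega) fun y hy => h y (.inl hy),
        ih B ρ ρ' (by omega) fun y hy => h y (.inr hy)]
    case par A B =>
      erw [ih A.neg ρ ρ' (by rw [Con.size_neg]; omega)
          fun y hy => h y (.inl (by rwa [Con.fresh_neg] at hy)),
        ih B.neg ρ ρ' (by rw [Con.size_neg]; omega)
          fun y hy => h y (.inr (by rwa [Con.fresh_neg] at hy))]
      rfl
    case ex x σ a A | all x σ a A =>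
      congr 1
      · funext v
        exact ih A _ _ hn (update_agree v fun y hy => h y (.inr hy))
      · funext v
        exact ih A.neg _ _ (by rwa [Con.size_neg])
          (update_agree v fun y hy => h y (.inr (by rwa [Con.fresh_neg] at hy)))
    case down A => rw [ih A ρ ρ' hn h]
    case up A =>
      erw [ih A.neg ρ ρ' (by rwa [Con.size_neg])
          fun y hy => h y (by rwa [Con.fresh_neg] at hy)]
      rfl
    case eqn T U a A =>
      rw [ih T ρ ρ' (by omega) fun y hy => h y (.inl (.inl hy)),
        ih U ρ ρ' (by omega) fun y hy => h y (.inl (.inr hy)),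
        ih A ρ ρ' (by omega) fun y hy => h y (.inr hy)]
    all_goals rfl

/-- Lets the names bound by the forcing translation be erased from the valuation in which its
components are interpreted. -/
theorem interp_update_of_fresh_le {σ τ : Kind} (T : Con P σ) (ρ : D.Valuation) {x : ℕ}
    (hx : T.fresh ≤ x) (v : D.Sem τ) : D.interp I T (update ρ x τ v) = D.interp I T ρ :=
  interp_congr I T.size T _ _ le_rfl fun y hy τ' =>
    update_of_ne ρ τ τ' v (by omega)

/-! ### Computing individuals and formulas -/

/-- The natural number `n` in the interpretation of `ι`. -/
def natSem (D : PropDomain bot) (n : ℕ) : D.Sem .ind := n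

/-- The interpretation of an individual, as a natural number. -/
noncomputable def natVal (T : Con P .ind) (ρ : D.Valuation) : ℕ := D.interp I T ρ

/-- The interpretation of a formula, as a set of weighted values. -/
noncomputable def valueSet {a : Pol} (A : Con P (.o a)) (ρ : D.Valuation) :
    Set (CVal Kp Kn a × M) := (D.interp I A ρ).1

/-- The set of weighted values obtained from an element of the interpretation of `ι → o^a` at the
individual `n`. -/
def valueAt {a : Pol} (F : D.Sem (.arr .ind (.o a))) (n : ℕ) : Set (CVal Kp Kn a × M) :=
  (show D.Sem (.o a) from (show ℕ → D.Sem (.o a) from F) n).1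

theorem natVal_numeral (ρ : D.Valuation) (n : ℕ) : natVal I (Con.numeral n) ρ = n := by
  induction n with
  | zero => simp only [natVal, Con.numeral, interp]
  | succ n ih =>
    simp only [natVal, Con.numeral, interp]
    exact congrArg (· + 1) ih

theorem natVal_var_update (ρ : D.Valuation) (x n : ℕ) :
    natVal I (.var x .ind) (update ρ x .ind (D.natSem n)) = n := by
  simp only [natVal, interp]; exact update_same _ _ _ _

theorem natVal_var_update_of_ne (ρ : D.Valuation) {x y : ℕ} (n : ℕ) (h : x ≠ y) :
    natVal I (.var y .ind) (update ρ x .ind (D.natSem n)) = natVal I (.var y .ind) ρ := by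
  simp only [natVal, interp]; exact update_of_ne _ _ _ _ h

/-- The arguments are evaluated outside the abstractions of `plus`, so its bound names 0 and 1
capture nothing; it remains to compute the recursor by induction on the second argument. -/
theorem natVal_add (T U : Con P .ind) (ρ : D.Valuation) :
    natVal I (Con.add T U) ρ = natVal I T ρ + natVal I U ρ := by
  have h (m n : ℕ) : natVal I (.app (.app (.app (.recur .ind) (.var 0 .ind))
      (.lam 2 .ind .succ)) (.var 1 .ind))
      (update (update ρ 0 .ind (D.natSem m)) 1 .ind (D.natSem n)) = m + n := by
    simp only [natVal, interp, update_same]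
    rw [update_of_ne _ _ _ _ (by decide), update_same]
    induction n with
    | zero => rfl
    | succ n ih => exact congrArg (· + 1) ih
  rw [← h]
  simp only [natVal, Con.add, Con.plus, interp]
  rfl

theorem valueAt_lam {a : Pol} (x : ℕ) (A : Con P (.o a)) (ρ : D.Valuation) (n : ℕ) :
    valueAt (D.interp I (.lam x .ind A) ρ) n =
      valueSet I A (update ρ x .ind (D.natSem n)) := by
  simp only [interp]; rfl

theorem valueSet_app {a : Pol} (Z : Con P (.arr .ind (.o a))) (T : Con P .ind)
    (ρ : D.Valuation) : valueSet I (.app Z T) ρ = valueAt (D.interp I Z ρ) (natVal I T ρ) := by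
  simp only [valueSet, interp]; rfl

theorem valueAt_pred (c : P) (ρ : D.Valuation) (n : ℕ) :
    valueAt (D.interp I (.pred c) ρ) n = (I c n).1 := by
  simp only [interp]; rfl

theorem valueSet_var (x : ℕ) (ρ : D.Valuation) :
    valueSet I (.var x (.o .pos)) ρ = (ρ x (.o .pos)).1 := by
  simp only [valueSet, interp]

theorem valueSet_dvar (x : ℕ) (ρ : D.Valuation) :
    valueSet (a := .neg) I (.dvar x (.o .pos)) ρ = orth bot (ρ x (.o .pos)).1 := by
  have h : D.interp I (.dvar x (.o .pos)) ρ = D.bott (.o .pos) (ρ x (.o .pos)) := by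
    simp only [interp]
  exact congrArg Subtype.val h

theorem valueSet_down {a : Pol} (A : Con P (.o a)) (ρ : D.Valuation) :
    valueSet I (.down A) ρ = downSet (valueSet I A ρ) := by
  simp only [valueSet, interp]; rfl

theorem valueSet_tensor {a b : Pol} (A : Con P (.o a)) (B : Con P (.o b)) (ρ : D.Valuation) :
    valueSet I (.tensor A B) ρ = tensorSet (valueSet I A ρ) (valueSet I B ρ) := by
  simp only [valueSet, interp]; rfl

theorem valueSet_par {a b : Pol} (A : Con P (.o a)) (B : Con P (.o b)) (ρ : D.Valuation) :
    valueSet I (.par A B) ρ = orth bot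
      (tensorSet (valueSet (a := a.dual) I A.neg ρ) (valueSet (a := b.dual) I B.neg ρ)) := by
  simp only [valueSet, interp]; rfl

theorem valueSet_up {a : Pol} (A : Con P (.o a)) (ρ : D.Valuation) :
    valueSet I (.up A) ρ = orth bot (downSet (valueSet (a := a.dual) I A.neg ρ)) := by
  simp only [valueSet, interp]; rfl

theorem valueSet_ex_ind (x : ℕ) (A : Con P (.o .pos)) (ρ : D.Valuation) :
    valueSet I (.ex x .ind A) ρ =
      ⋃ n : ℕ, valueSet I A (update ρ x .ind (D.natSem n)) := by
  simp only [valueSet, interp]; rfl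

theorem valueSet_all_ind (x : ℕ) (A : Con P (.o .neg)) (ρ : D.Valuation) :
    valueSet I (.all x .ind A) ρ =
      orth bot (⋃ n : ℕ, valueSet (a := .pos) I A.neg (update ρ x .ind (D.natSem n))) := by
  simp only [valueSet, interp]; rfl

/-- A union indexed by the proofs of the equation replaces the case distinction, to match the shape
of `slice_tensorSet`. It relies on the default value for positive formulas being ∅. -/
theorem valueSet_eqn_ind (T U : Con P .ind) (A : Con P (.o .pos)) (ρ : D.Valuation) :
    valueSet I (.eqn T U A) ρ = ⋃ _ : natVal I T ρ = natVal I U ρ, valueSet I A ρ := by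
  simp only [valueSet, interp]
  by_cases h : natVal I T ρ = natVal I U ρ
  · rw [if_pos (show D.interp I T ρ = D.interp I U ρ from h)]
    simp [h]
  · rw [if_neg (show ¬D.interp I T ρ = D.interp I U ρ from h)]
    simp only [h, Set.iUnion_of_empty]
    rfl

/-! ### Interpretation of the forcing connectives -/

section Forcing

variable (I : Unit → ℕ → D.Sem (.o .pos)) (ρ : D.Valuation)

theorem valueAt_forcDown {a : Pol} (Z : Con Unit (.arr .ind (.o a))) (r : ℕ) :
    valueAt (D.interp I (forcDown Z) ρ) r = downSet (valueAt (D.interp I Z ρ) r) := by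
  rw [forcDown, valueAt_lam, valueSet_down, valueSet_app, natVal_var_update,
    interp_update_of_fresh_le I Z ρ le_rfl]

theorem valueAt_forcTensor {a b : Pol} (Z : Con Unit (.arr .ind (.o a)))
    (W : Con Unit (.arr .ind (.o b))) (r : ℕ) :
    valueAt (D.interp I (forcTensor Z W) ρ) r = ⋃ q : ℕ, ⋃ s : ℕ, ⋃ _ : r = q + s,
      tensorSet (valueAt (D.interp I Z ρ) q) (valueAt (D.interp I W ρ) s) := by
  have hZ : Z.fresh ≤ max Z.fresh W.fresh := le_max_left _ _
  have hW : W.fresh ≤ max Z.fresh W.fresh := le_max_right _ _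
  simp only [forcTensor]
  -- The bound names become m, m + 1, m + 2: distinct, and fresh for both components.
  generalize max Z.fresh W.fresh = m at hZ hW
  simp only [valueAt_lam, valueSet_ex_ind, valueSet_eqn_ind, natVal_add, valueSet_tensor,
    valueSet_app, natVal_var_update]
  simp only [natVal_var_update_of_ne _ _ _ (show m + 2 ≠ m by omega),
    natVal_var_update_of_ne _ _ _ (show m + 1 ≠ m by omega),
    natVal_var_update_of_ne _ _ _ (show m + 2 ≠ m + 1 by omega), natVal_var_update,
    interp_update_of_fresh_le I Z _ hZ,
    interp_update_of_fresh_le I Z _ (show Z.fresh ≤ m + 1 by omega),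
    interp_update_of_fresh_le I Z _ (show Z.fresh ≤ m + 2 by omega),
    interp_update_of_fresh_le I W _ hW,
    interp_update_of_fresh_le I W _ (show W.fresh ≤ m + 1 by omega),
    interp_update_of_fresh_le I W _ (show W.fresh ≤ m + 2 by omega)]

theorem valueAt_forcOrtho {a : Pol} (Z : Con Unit (.arr .ind (.o a))) (r : ℕ) :
    valueAt (D.interp I (forcOrtho Z) ρ) r =
      orth bot (⋃ q : ℕ, tensorSet (valueAt (D.interp I Z ρ) q) (I () (r + q)).1) := by
  -- A negative ∀ is interpreted through the negation of its body. For an implication this is a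
  -- tensor whose left factor is a double negation of Z, removed by `Con.neg_neg_heq`.
  have h (x q : ℕ) (hx : Z.fresh ≤ x) (T : Con Unit .ind) (ρ' : D.Valuation) :
      valueSet (a := .pos) I
        (Con.lolli (.app Z (.var x .ind)) (b := .neg) (condPred T).neg).neg
        (update ρ' x .ind (D.natSem q)) =
      tensorSet (valueAt (D.interp I Z ρ') q)
        (I () (natVal I T (update ρ' x .ind (D.natSem q)))).1 := by
    have e : (Con.lolli (.app Z (.var x .ind)) (b := .neg) (condPred T).neg).neg =
        Con.tensor (.app Z (.var x .ind)) (condPred T) := by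
      cases a <;> exact congrArg (fun Y => Con.tensor (.app Y (.var x .ind)) (condPred T))
        (eq_of_heq Z.neg_neg_heq)
    rw [e, valueSet_tensor, valueSet_app, natVal_var_update, interp_update_of_fresh_le I Z _ hx,
      condPred, valueSet_app, valueAt_pred]
  simp only [forcOrtho, valueAt_lam, valueSet_all_ind]
  simp only [h _ _ (Nat.le_succ Z.fresh), natVal_add, natVal_var_update,
    natVal_var_update_of_ne _ _ _ (Nat.succ_ne_self Z.fresh),
    interp_update_of_fresh_le I Z ρ le_rfl]

end Forcing

end PropDomain

/-! ### Slices of weighted sets -/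

section Connection

variable {Kp Kn : Type} {num : ℕ ↪ Kp} {B : CountdownPole Kn num}

/-- Quantification over all counters allowed by the quantitative pole turns into pairing each value
with every element of 𝒞[p + q]; the simple pole reads such a pair back as a value and its counter.
-/
theorem slice_orth (X : Set (CVal Kp Kn .pos × ℕ)) (p : ℕ) :
    slice (orth B.quant X) p =
      orth B.simple (⋃ q : ℕ, tensorSet (slice X q) (condSet Kn num (p + q))) := by
  ext ⟨t, u⟩
  constructor
  · rintro h ⟨w, _⟩ hw
    obtain ⟨q, ⟨v, _⟩, hv, _, ⟨n, hn, rfl⟩, hw⟩ := Set.mem_iUnion.1 hw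
    obtain ⟨rfl, -⟩ := Prod.mk.inj hw
    exact ⟨.pos, v, numVal num n, t, rfl, h (v, q) hv _ ⟨n, by rwa [add_comm], rfl⟩⟩
  · rintro h ⟨v, q⟩ hv _ ⟨n, hn, rfl⟩
    obtain ⟨a, v', K, t', h1, h2⟩ := h (Expr.pair v (numVal num n), ())
      (Set.mem_iUnion.2 ⟨q, (v, ()), hv, (numVal num n, ()), ⟨n, by rwa [add_comm], rfl⟩, rfl⟩)
    -- The simple pole only asserts that some decomposition into value, counter and negative term
    -- exists; injectivity of the constructors makes it the expected one.
    simp only [Expr.cut.injEq, Expr.ofVal.injEq, Expr.pair.injEq] at h1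
    obtain ⟨⟨-, rfl, h3, h4⟩, rfl⟩ := h1
    obtain rfl := eq_of_heq h3
    obtain rfl := eq_of_heq h4
    exact h2

theorem slice_tensorSet {a b : Pol} (X : Set (CVal Kp Kn a × ℕ)) (Y : Set (CVal Kp Kn b × ℕ))
    (p : ℕ) : slice (tensorSet X Y) p =
      ⋃ q : ℕ, ⋃ r : ℕ, ⋃ _ : p = q + r, tensorSet (slice X q) (slice Y r) := by
  ext ⟨z, u⟩
  simp only [Set.mem_iUnion]
  constructor
  · rintro ⟨⟨x, q⟩, hx, ⟨y, r⟩, hy, h⟩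
    obtain ⟨rfl, rfl⟩ := Prod.mk.inj h
    exact ⟨q, r, rfl, (x, ()), hx, (y, ()), hy, rfl⟩
  · rintro ⟨q, r, rfl, ⟨x, _⟩, hx, ⟨y, _⟩, hy, h⟩
    obtain ⟨rfl, -⟩ := Prod.mk.inj h
    exact ⟨(x, q), hx, (y, r), hy, rfl⟩

theorem slice_downSet {a : Pol} (X : Set (CVal Kp Kn a × ℕ)) (p : ℕ) :
    slice (downSet X) p = downSet (slice X p) := by
  ext ⟨z, u⟩
  constructor
  · rintro ⟨⟨x, q⟩, hx, h⟩
    obtain ⟨rfl, rfl⟩ := Prod.mk.inj h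
    exact ⟨(x, ()), hx, rfl⟩
  · rintro ⟨⟨x, _⟩, hx, h⟩
    obtain ⟨rfl, -⟩ := Prod.mk.inj h
    exact ⟨(x, p), hx, rfl⟩

/-! ### The connection lemma -/

open PropDomain

/-- The value at `p` of the forcing translation of a formula is the set of the elements of weight
`p` of its quantitative interpretation. -/
theorem valueAt_star (D : PropDomain B.simple) (hD : ∀ p, condSet Kn num p ∈ D.carrier)
    (I : Unit → ℕ → D.Sem (.o .pos)) (hI : ∀ q, (I () q).1 = condSet Kn num q)
    (J : Empty → ℕ → (quantDomain D hD).Sem (.o .pos))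
    (ρ : D.Valuation) (ρQ : (quantDomain D hD).Valuation)
    (hρQ : ∀ X : ℕ, (ρQ X (.o .pos)).1 = rhoQuant ρ X) (n : ℕ) :
    ∀ {a : Pol} (C : MAL a) (_ : C.size ≤ n) (p : ℕ),
      valueAt (D.interp I C.star ρ) p = slice (valueSet J C.toCon ρQ) p := by
  have hvar (X p : ℕ) : valueAt (D.interp I (.var X (.arr .ind (.o .pos))) ρ) p =
      slice (ρQ X (.o .pos)).1 p := by
    rw [hρQ, interp]; rfl
  induction n with
  | zero => intro a C hC; cases C <;> simp [MAL.size] at hC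
  | succ n ih =>
    intro a C hC p
    cases C <;> simp only [MAL.size, Nat.add_le_add_iff_right] at hC <;>
      rw [MAL.star, MAL.toCon]
    case var X => rw [hvar, valueSet_var]
    case dvar X =>
      simp only [valueAt_forcOrtho, hvar, hI]
      rw [← slice_orth, valueSet_dvar]
    case tensor A B =>
      simp only [valueAt_forcTensor, ih A (by omega), ih B (by omega)]
      rw [← slice_tensorSet, valueSet_tensor]
    -- Both sides are orthogonals of the tensor of the negations, which have the sizes of A and B;
    -- hence the induction on size.
    case par A B =>
      simp only [valueAt_forcOrtho, valueAt_forcTensor, ih A.neg (by rw [MAL.size_neg]; omega),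
        ih B.neg (by rw [MAL.size_neg]; omega), ← slice_tensorSet, MAL.toCon_neg, hI]
      rw [← slice_orth, valueSet_par]
    case down A =>
      rw [valueAt_forcDown, ih A hC, ← slice_downSet, valueSet_down]
    case up A =>
      simp only [valueAt_forcOrtho, valueAt_forcDown, ih A.neg (by rwa [MAL.size_neg]),
        ← slice_downSet, MAL.toCon_neg, hI]
      rw [← slice_orth, valueSet_up]

end Connection

end MALForcing

open MALForcing
theorem mainTheorem6 {Kp Kn : Type} (num : ℕ ↪ Kp) (B : CountdownPole Kn num)
    (D : PropDomain B.simple) (hD : ∀ p, condSet Kn num p ∈ D.carrier)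
    (ρ : D.Valuation) (ρQ : (quantDomain D hD).Valuation)
    (hρQ : ∀ X : ℕ, (ρQ X (.o .pos)).1 = rhoQuant ρ X)
    {a : Pol} (C : MAL a) (t : CTerm Kp Kn) (p : ℕ) :
    (t, ()) ∈ D.den (fun _ q => ⟨condSet Kn num q, hD q⟩) (.app C.star (Con.numeral p)) ρ ↔
      (t, p) ∈ (quantDomain D hD).den Empty.elim C.toCon ρQ := by
  let I : Unit → ℕ → D.Sem (.o .pos) := fun _ q => ⟨condSet Kn num q, hD q⟩
  have h : PropDomain.valueSet I (.app C.star (Con.numeral p)) ρ =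
      slice (PropDomain.valueSet Empty.elim C.toCon ρQ) p := by
    rw [PropDomain.valueSet_app, PropDomain.natVal_numeral]
    exact valueAt_star D hD I (fun _ => rfl) _ ρ ρQ hρQ C.size C le_rfl p
  -- Denotations are images of value sets under `toTerm`, so the same value x witnesses membership
  -- on both sides; only its weight changes.
  constructor
  · rintro ⟨⟨x, _⟩, hx, hxt⟩
    obtain ⟨rfl, -⟩ := Prod.mk.inj hxt
    exact ⟨(x, p), (Set.ext_iff.1 h (x, ())).1 hx, rfl⟩
  · rintro ⟨⟨x, q⟩, hx, hxt⟩
    obtain ⟨rfl, rfl⟩ := Prod.mk.inj hxt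
    exact ⟨(x, ()), (Set.ext_iff.1 h (x, ())).2 hx, rfl⟩
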